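/- Let $p$ be a nonzero real number, let $\mathcal A,\mathcal B$ be unital (complex) $C^*$-algebras, and let $\mathcal A^{++}$ and $\mathcal B^{++}$ denote their positive definite cones, i.e. the sets of all invertible positive elements. For $A,B$ in a positive definite cone let $$A\,\mathsf m_p\,B=\left(\frac{A^p+B^p}{2}\right)^{1/p}$$ be the conventional $p$th power mean (powers are taken in the sense of the continuous functional calculus). Let $\phi:\mathcal A^{++}\to\mathcal B^{++}$ be a bijective map. Then $$\phi(A\,\mathsf m_p\,B)=\phi(A)\,\mathsf m_p\,\phi(B)\qquad\text{for all }A,B\in\mathcal A^{++}$$ if and only if there are a Jordan *-isomorphism $J:\mathcal A\to\mathcal B$ and an element $D\in\mathcal B^{++}$ such that $$\phi(A)=(D\,J(A)^p\,D)^{1/p}\qquad\text{for all }A\in\mathcal A^{++}.$$ Here a Jordan *-isomorphism is a bijective complex-linear map $J:\mathcal A\to\mathcal B$ with $J(XY+YX)=J(X)J(Y)+J(Y)J(X)$ and $J(X^*)=J(X)^*$ for all $X,Y\in\mathcal A$. -/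

import Mathlib

/-- The positive definite cone of a unital C*-algebra: the invertible elements among the
positive semidefinite ones, `0` being below `a` in the order of the C*-algebra. -/
def PosDefCone (A : Type*) [CStarAlgebra A] [PartialOrder A] : Type _ :=
  {a : A // IsStrictlyPositive a}

/-- An element of the positive definite cone, as an element of the algebra. -/
def PosDefCone.val {A : Type*} [CStarAlgebra A] [PartialOrder A] (a : PosDefCone A) : A :=
  Subtype.val a

theorem PosDefCone.isStrictlyPositive {A : Type*} [CStarAlgebra A] [PartialOrder A]
    (a : PosDefCone A) : IsStrictlyPositive a.val :=
  Subtype.property a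

/-- The formula of the conventional power mean produces positive definite elements. -/
theorem isStrictlyPositive_powerMean {A : Type*} [CStarAlgebra A] [PartialOrder A]
    [StarOrderedRing A] (p : ℝ) {a b : A} (ha : IsStrictlyPositive a)
    (hb : IsStrictlyPositive b) :
    IsStrictlyPositive (((1 / 2 : ℝ) • (a ^ p + b ^ p)) ^ (1 / p)) := by
  have h1 : IsStrictlyPositive (a ^ p) := ha.rpow a p
  have h2 : IsStrictlyPositive (b ^ p) := hb.rpow b p
  have h3 : IsStrictlyPositive (a ^ p + b ^ p) := h1.add_nonneg h2.nonneg
  have h4 : IsStrictlyPositive ((1 / 2 : ℝ) • (a ^ p + b ^ p)) := h3.smul (by norm_num)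
  exact h4.rpow _ _

/-- The conventional `p`-th power mean `((a ^ p + b ^ p) / 2) ^ (1 / p)` on the positive definite
cone, with the powers of the continuous functional calculus. -/
noncomputable def powerMean {A : Type*} [CStarAlgebra A] [PartialOrder A] [StarOrderedRing A]
    (p : ℝ) (a b : PosDefCone A) : PosDefCone A :=
  ⟨((1 / 2 : ℝ) • (a.val ^ p + b.val ^ p)) ^ (1 / p),
    isStrictlyPositive_powerMean p a.isStrictlyPositive b.isStrictlyPositive⟩

/-- A Jordan *-isomorphism: a linear bijection that preserves the Jordan product and the star. -/
structure JordanStarIso (A B : Type*) [CStarAlgebra A] [CStarAlgebra B] extends A ≃ₗ[ℂ] B where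
  map_jordan : ∀ x y : A, toFun (x * y + y * x) = toFun x * toFun y + toFun y * toFun x
  map_star : ∀ x : A, toFun (star x) = star (toFun x)

/-!
The power `a ↦ a ^ p` is a bijection of the positive definite cone that turns the power mean into
the arithmetic mean (`PosDefCone.rpowEquiv_powerMean`). The theorem thus describes the bijections
`ψ` between positive definite cones that preserve midpoints, once it is known that a Jordan
*-isomorphism `J` satisfies `J (a ^ p) = (J a) ^ p`.

Such a `ψ` is additive up to a constant: `ψ a - ψ b` depends only on `a - b`, and it is additive and
monotone in `a - b`, because `ψ` stays positive along every ray. A monotone additive map is bounded,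
so it is real linear and complexifies to a positive linear map `T` with `ψ = T + c`
(`exists_positiveLinearMap_add_const`). The constant is nonnegative for both `ψ` and its inverse,
which forces it to vanish: `ψ` is the restriction of a linear order isomorphism
(`exists_inverse_positiveLinearMaps`). With `D` the square root of `T 1`, the map `D⁻¹ T(·) D⁻¹` is
a unital linear order isomorphism, hence a Jordan *-isomorphism by Kadison's theorem
(`exists_jordanStarIso_of_inverse_positiveLinearMaps`).

Kadison's theorem follows from the inequality `Φ a ^ 2 ≤ Φ (a ^ 2)` for unital positive maps `Φ`,
applied to the isomorphism and to its inverse. For `0 ≤ a ≤ 1` the inequality is read off the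
Bernstein polynomials of `a`: their images under `Φ` are a partition of unity by nonnegative
elements `q k`, and the nonnegativity of the operator-valued variance
`∑ (k - n Φ a) q k (k - n Φ a)` gives the inequality up to an error of order `1 / n`.

A Jordan *-isomorphism preserves squares and thus positivity, so it is continuous. Since it also
preserves the powers of an element, it commutes with the continuous functional calculus by
polynomial approximation (`JordanStarIso.map_cfc`), in particular with real powers.
-/

/-! ### Midpoint-preserving maps between positive definite cones -/

open ComplexStarModule Filter Topology

section AffineMaps

variable {A : Type*} [CStarAlgebra A] [PartialOrder A] [StarOrderedRing A]

/-- The order of a C*-algebra is Archimedean. -/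
theorem nonneg_of_forall_pos_add_smul {y z : A} (h : ∀ ε : ℝ, 0 < ε → 0 ≤ y + ε • z) : 0 ≤ y := by
  have ht : Tendsto (fun ε : ℝ => y + ε • z) (𝓝[>] 0) (𝓝 y) := by
    have : Continuous (fun ε : ℝ => y + ε • z) := by fun_prop
    simpa using (this.tendsto 0).mono_left nhdsWithin_le_nhds
  exact ge_of_tendsto ht (eventually_nhdsWithin_of_forall h)

theorem nonneg_of_forall_nsmul_add_nonneg {y z : A} (h : ∀ n : ℕ, 0 ≤ n • y + z) : 0 ≤ y := by
  have hz : 0 ≤ z := by simpa using h 0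
  refine nonneg_of_forall_pos_add_smul (z := z) fun ε hε => ?_
  obtain ⟨n, hn⟩ := exists_nat_gt ε⁻¹
  have hn0 : (0 : ℝ) < n := (inv_pos.2 hε).trans hn
  have h2 : 0 ≤ (n : ℝ)⁻¹ • (n • y + z) := smul_nonneg (by positivity) (h n)
  rw [smul_add, ← Nat.cast_smul_eq_nsmul ℝ, smul_smul, inv_mul_cancel₀ hn0.ne', one_smul] at h2
  refine h2.trans ?_
  gcongr
  exact inv_le_of_inv_le₀ hε hn.le

/-- A scalar exceeding the norm of a self-adjoint element pushes it into the positive definite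
cone. -/
theorem IsSelfAdjoint.isStrictlyPositive_smul_one_add {x : A} (hx : IsSelfAdjoint x) {c : ℝ}
    (hc : ‖x‖ < c) : IsStrictlyPositive (c • (1 : A) + x) := by
  have h1 : 0 ≤ algebraMap ℝ A ‖x‖ + x := by
    have := hx.neg_algebraMap_norm_le_self
    rwa [neg_le_iff_add_nonneg'] at this
  have h2 : IsStrictlyPositive ((c - ‖x‖) • (1 : A)) :=
    isStrictlyPositive_one.smul (sub_pos.2 hc)
  have h3 := h2.add_nonneg h1
  rwa [Algebra.algebraMap_eq_smul_one, sub_smul, ← add_assoc, sub_add_cancel] at h3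

/-- If `ψ` preserves midpoints, then `ψ a - ψ b` depends only on `a - b`, and additively so. -/
theorem exists_addMonoidHom_of_map_midpoint {B : Type*} [CStarAlgebra B] (ψ : A → B)
    (hψ : ∀ a b, IsStrictlyPositive a → IsStrictlyPositive b →
      ψ ((1 / 2 : ℝ) • (a + b)) = (1 / 2 : ℝ) • (ψ a + ψ b)) :
    ∃ L : selfAdjoint A →+ B, ∀ (x : selfAdjoint A) (a b : A), IsStrictlyPositive a →
      IsStrictlyPositive b → (x : A) = a - b → L x = ψ a - ψ b := by
  have key : ∀ a b c d : A, IsStrictlyPositive a → IsStrictlyPositive b →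
      IsStrictlyPositive c → IsStrictlyPositive d → a - b = c - d → ψ a - ψ b = ψ c - ψ d := by
    intro a b c d ha hb hc hd h
    have h1 : a + d = c + b := by rwa [sub_eq_sub_iff_add_eq_add] at h
    have h2 := hψ a d ha hd
    rw [h1, hψ c b hc hb] at h2
    have h3 : ψ c + ψ b = ψ a + ψ d :=
      smul_right_injective B (by norm_num : (1 / 2 : ℝ) ≠ 0) h2
    rw [sub_eq_sub_iff_add_eq_add, h3]
  have hsp : ∀ (x : selfAdjoint A) (c : ℝ), ‖(x : A)‖ < c →
      IsStrictlyPositive (c • (1 : A) + x) := fun x c hc =>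
    IsSelfAdjoint.isStrictlyPositive_smul_one_add x.2 hc
  have hone : ∀ c : ℝ, 0 < c → IsStrictlyPositive (c • (1 : A)) := fun c hc =>
    isStrictlyPositive_one.smul hc
  -- `x` is the difference of the strictly positive elements `(‖x‖ + 1) • 1 + x` and `(‖x‖ + 1) • 1`
  let f : selfAdjoint A → B := fun x =>
    ψ ((‖(x : A)‖ + 1) • (1 : A) + x) - ψ ((‖(x : A)‖ + 1) • (1 : A))
  have hf : ∀ (x : selfAdjoint A) (a b : A), IsStrictlyPositive a →
      IsStrictlyPositive b → (x : A) = a - b → f x = ψ a - ψ b := fun x a b ha hb hx =>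
    key _ _ _ _ (hsp x _ (lt_add_one _)) (hone _ (by positivity)) ha hb (by simpa using hx)
  refine ⟨AddMonoidHom.mk' f fun x y => ?_, hf⟩
  -- with `c` large, `f y` telescopes through `c • 1 + x`
  let c : ℝ := ‖(x : A)‖ + ‖(y : A)‖ + 1
  have hx : ‖(x : A)‖ < c := by have := norm_nonneg (y : A); simp only [c]; linarith
  have hxy : ‖((x + y : selfAdjoint A) : A)‖ < c := by
    have := norm_add_le (x : A) y
    simp only [c, AddSubgroup.coe_add]; linarith
  have hc : 0 < c := (norm_nonneg _).trans_lt hx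
  rw [hf x _ _ (hsp x c hx) (hone c hc) (by simp),
    hf y _ _ (hsp (x + y) c hxy) (hsp x c hx) (by simp),
    hf (x + y) _ _ (hsp (x + y) c hxy) (hone c hc) (by simp)]
  abel

variable {B : Type*} [CStarAlgebra B] [PartialOrder B] [StarOrderedRing B]

/-- An additive map of the self-adjoint part that preserves nonnegativity is bounded, hence real
linear, and extends to a positive complex linear map. -/
theorem exists_positiveLinearMap_extending (L : selfAdjoint A →+ B)
    (hL : ∀ x : selfAdjoint A, 0 ≤ (x : A) → 0 ≤ L x) :
    ∃ T : A →ₚ[ℂ] B, ∀ x : selfAdjoint A, T x = L x := by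
  have hcont : Continuous L := by
    refine L.continuous_of_isBounded_nhds_zero (Metric.ball_mem_nhds 0 one_pos)
      (isBounded_iff_forall_norm_le.2 ⟨3 * ‖L 1‖, ?_⟩)
    rintro _ ⟨x, hx, rfl⟩
    have hx1 : ‖(x : A)‖ ≤ 1 := by simpa using (mem_ball_zero_iff.1 hx).le
    have hle : algebraMap ℝ A ‖(x : A)‖ ≤ 1 := by
      simpa using algebraMap_mono (α := ℝ) A hx1
    have h1 : (x : A) ≤ 1 := (IsSelfAdjoint.le_algebraMap_norm_self x.2).trans hle
    have h2 : 0 ≤ 1 + (x : A) := by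
      have := (neg_le_neg hle).trans (IsSelfAdjoint.neg_algebraMap_norm_le_self x.2)
      rwa [neg_le_iff_add_nonneg'] at this
    have h3 : 0 ≤ L 1 + L x := by rw [← map_add]; exact hL _ (by simpa using h2)
    have h4 : L 1 + L x ≤ L 1 + L 1 := by
      have := hL (1 - x) (by simpa using h1)
      rw [map_sub, sub_nonneg] at this
      gcongr
    have h5 := CStarAlgebra.norm_le_norm_of_nonneg_of_le h3 h4
    calc ‖L x‖ = ‖(L 1 + L x) - L 1‖ := by rw [add_sub_cancel_left]
      _ ≤ ‖L 1 + L x‖ + ‖L 1‖ := norm_sub_le _ _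
      _ ≤ (‖L 1‖ + ‖L 1‖) + ‖L 1‖ := by gcongr; exact h5.trans (norm_add_le _ _)
      _ = 3 * ‖L 1‖ := by ring
  let R : selfAdjoint A →L[ℝ] B := L.toRealLinearMap hcont
  -- the complexification of `R`
  let T : A →ₗ[ℂ] B :=
    { toFun := fun x => R (ℜ x) + Complex.I • R (ℑ x)
      map_add' := fun x y => by simp only [map_add, smul_add]; abel
      map_smul' := fun z x => by
        rw [realPart_smul, imaginaryPart_smul]
        simp only [map_sub, map_add, map_smul, RingHom.id_apply]
        conv_rhs => rw [← Complex.re_add_im z]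
        simp only [add_smul, smul_add, ← smul_smul, Complex.coe_smul,
          smul_comm Complex.I (_ : ℝ)]
        rw [smul_smul Complex.I, Complex.I_mul_I, neg_one_smul, smul_neg]
        abel }
  have hT : ∀ x : selfAdjoint A, T x = L x := fun x => by
    have h1 : ℜ (x : A) = x := Subtype.ext (IsSelfAdjoint.coe_realPart x.2)
    have h2 : ℑ (x : A) = 0 := IsSelfAdjoint.imaginaryPart x.2
    change R (ℜ (x : A)) + Complex.I • R (ℑ (x : A)) = L x
    rw [h1, h2, map_zero, smul_zero, add_zero]
    rfl
  refine ⟨PositiveLinearMap.mk₀ T fun x hx => ?_, hT⟩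
  have := hT ⟨x, hx.isSelfAdjoint⟩
  simp only at this
  rw [this]
  exact hL _ hx

/-- A midpoint-preserving map from one positive definite cone to another is the restriction of a
positive linear map, up to an additive constant. -/
theorem exists_positiveLinearMap_add_const (ψ : A → B)
    (hψ : ∀ a b, IsStrictlyPositive a → IsStrictlyPositive b →
      ψ ((1 / 2 : ℝ) • (a + b)) = (1 / 2 : ℝ) • (ψ a + ψ b))
    (hpos : ∀ a, IsStrictlyPositive a → IsStrictlyPositive (ψ a)) :
    ∃ (T : A →ₚ[ℂ] B) (c : B), 0 ≤ c ∧ ∀ a, IsStrictlyPositive a → ψ a = T a + c := by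
  obtain ⟨L, hL⟩ := exists_addMonoidHom_of_map_midpoint ψ hψ
  have h1 : IsStrictlyPositive (1 : A) := isStrictlyPositive_one
  obtain ⟨T, hT⟩ := exists_positiveLinearMap_extending L fun x hx => by
    -- along the ray `1 + n x` the values `ψ 1 + n (L x)` stay nonnegative
    refine nonneg_of_forall_nsmul_add_nonneg (z := ψ 1) fun n => ?_
    have hs : IsStrictlyPositive (1 + n • (x : A)) := h1.add_nonneg (nsmul_nonneg hx n)
    rw [← map_nsmul, hL (n • x) _ _ hs h1 (by simp), sub_add_cancel]
    exact (hpos _ hs).nonneg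
  have hTc : ∀ a, IsStrictlyPositive a → ψ a = T a + (ψ 1 - T 1) := fun a ha => by
    have := hL (⟨a, ha.isSelfAdjoint⟩ - 1) a 1 ha h1 (by simp)
    rw [← hT] at this
    simp only [AddSubgroup.coe_sub, selfAdjoint.val_one, map_sub] at this
    rw [← sub_add_cancel (ψ a) (ψ 1), ← this]
    abel
  refine ⟨T, ψ 1 - T 1, ?_, hTc⟩
  refine nonneg_of_forall_pos_add_smul (z := T 1) fun ε hε => ?_
  have hs : IsStrictlyPositive (ε • (1 : A)) := h1.smul hε
  have := (hpos _ hs).nonneg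
  rwa [hTc _ hs, PositiveLinearMap.map_smul_of_tower, add_comm] at this

/-- A positive linear map is determined by its values on the positive definite cone. -/
theorem PositiveLinearMap.eq_of_eqOn_isStrictlyPositive {S T : A →ₚ[ℂ] B}
    (h : ∀ a, IsStrictlyPositive a → S a = T a) : S = T := by
  have hsa : ∀ x : A, IsSelfAdjoint x → S x = T x := fun x hx => by
    have h1 := h _ (hx.isStrictlyPositive_smul_one_add (lt_add_one _))
    have h2 := h _ (isStrictlyPositive_one (A := A))
    simpa [h2] using h1
  ext x
  rw [← realPart_add_I_smul_imaginaryPart x]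
  simp only [map_add, map_smul, hsa _ (ℜ x).2, hsa _ (ℑ x).2]

/-- A positive linear map that agrees with the identity up to an additive constant on the positive
definite cone is the identity, the constant being zero. -/
theorem PositiveLinearMap.eq_id_of_add_const (T : A →ₚ[ℂ] A) (e : A)
    (h : ∀ a, IsStrictlyPositive a → T a + e = a) : e = 0 ∧ T = PositiveLinearMap.id ℂ A := by
  -- compare the values at `1` and `2`
  have h1 := h 1 isStrictlyPositive_one
  have h2 := h ((2 : ℝ) • 1) (isStrictlyPositive_one.smul two_pos)
  rw [PositiveLinearMap.map_smul_of_tower, two_smul, two_smul] at h2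
  have he : e = 0 := by
    have h3 : e = ((T 1 + e) + (T 1 + e)) - (T 1 + T 1 + e) := by abel
    rwa [h2, h1, sub_self] at h3
  exact ⟨he, PositiveLinearMap.eq_of_eqOn_isStrictlyPositive fun a ha => by
    simpa [he] using h a ha⟩

/-- Mutually inverse midpoint-preserving maps between positive definite cones are the restrictions
of mutually inverse positive linear maps. -/
theorem exists_inverse_positiveLinearMaps (ψ : A → B) (χ : B → A)
    (hψ : ∀ a b, IsStrictlyPositive a → IsStrictlyPositive b →
      ψ ((1 / 2 : ℝ) • (a + b)) = (1 / 2 : ℝ) • (ψ a + ψ b))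
    (hχ : ∀ a b, IsStrictlyPositive a → IsStrictlyPositive b →
      χ ((1 / 2 : ℝ) • (a + b)) = (1 / 2 : ℝ) • (χ a + χ b))
    (hψpos : ∀ a, IsStrictlyPositive a → IsStrictlyPositive (ψ a))
    (hχpos : ∀ b, IsStrictlyPositive b → IsStrictlyPositive (χ b))
    (hχψ : ∀ a, IsStrictlyPositive a → χ (ψ a) = a)
    (hψχ : ∀ b, IsStrictlyPositive b → ψ (χ b) = b) :
    ∃ (T : A →ₚ[ℂ] B) (S : B →ₚ[ℂ] A), (∀ a, IsStrictlyPositive a → ψ a = T a) ∧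
      (∀ a, S (T a) = a) ∧ ∀ b, T (S b) = b := by
  obtain ⟨T, c, hc, hT⟩ := exists_positiveLinearMap_add_const ψ hψ hψpos
  obtain ⟨S, d, hd, hS⟩ := exists_positiveLinearMap_add_const χ hχ hχpos
  have hTS := PositiveLinearMap.eq_id_of_add_const (T.comp S) (T d + c) fun b hb => by
    have := hψχ b hb
    rwa [hT _ (hχpos b hb), hS b hb, map_add, add_assoc] at this
  have hST := PositiveLinearMap.eq_id_of_add_const (S.comp T) (S c + d) fun a ha => by
    have := hχψ a ha
    rwa [hS _ (hψpos a ha), hT a ha, map_add, add_assoc] at this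
  -- both summands of `T d + c = 0` are nonnegative
  have hc0 : c = 0 := by
    refine le_antisymm ?_ hc
    rw [← hTS.1]
    exact le_add_of_nonneg_left (T.map_nonneg hd)
  exact ⟨T, S, fun a ha => by rw [hT a ha, hc0, add_zero], DFunLike.congr_fun hST.2,
    DFunLike.congr_fun hTS.2⟩

end AffineMaps

/-! ### Kadison's inequality and Kadison's theorem -/

section Kadison

variable {A B : Type*} [CStarAlgebra A] [PartialOrder A] [StarOrderedRing A]
  [CStarAlgebra B] [PartialOrder B] [StarOrderedRing B]

open Polynomial in
/-- The Bernstein polynomials are nonnegative on `[0, 1]`, hence so are their values at `a` when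
`0 ≤ a ≤ 1`. -/
theorem aeval_bernsteinPolynomial_nonneg {a : A} (h0 : 0 ≤ a) (h1 : a ≤ 1) (n k : ℕ) :
    0 ≤ aeval a (bernsteinPolynomial ℝ n k) := by
  rw [← cfc_polynomial _ a h0.isSelfAdjoint]
  refine cfc_nonneg fun x hx => ?_
  have hx0 : 0 ≤ x := spectrum_nonneg_of_nonneg h0 hx
  have hx1 : x ≤ 1 := by
    have : a ≤ algebraMap ℝ A 1 := by simpa using h1
    exact (le_algebraMap_iff_spectrum_le h0.isSelfAdjoint).1 this x hx
  have := sub_nonneg.2 hx1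
  simp only [bernsteinPolynomial, eval_mul, eval_natCast, eval_pow, eval_X, eval_sub, eval_one]
  positivity

open Polynomial in
theorem bernsteinPolynomial_sum_sq_smul (R : Type*) [CommRing R] (n : ℕ) :
    ∑ k ∈ Finset.range (n + 1), (k * k) • bernsteinPolynomial R n k =
      (n * (n - 1)) • X ^ 2 + n • X := by
  rw [← bernsteinPolynomial.sum_mul_smul, ← bernsteinPolynomial.sum_smul,
    ← Finset.sum_add_distrib]
  refine Finset.sum_congr rfl fun k _ => ?_
  rw [← add_smul]
  congr 1
  cases k <;> simp; ring

open Polynomial in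
/-- Kadison's inequality for `0 ≤ a ≤ 1`: with the partitions of unity given by the Bernstein
polynomials of degree `n`, the nonnegativity of a variance yields it up to an error of order
`1 / n`. -/
theorem PositiveLinearMap.map_mul_self_le_map_mul_self_of_le_one (Φ : A →ₚ[ℂ] B) (hΦ : Φ 1 = 1)
    {a : A} (h0 : 0 ≤ a) (h1 : a ≤ 1) : Φ a * Φ a ≤ Φ (a * a) := by
  rw [← sub_nonneg]
  have hsa : IsSelfAdjoint (Φ a) := (Φ.map_nonneg h0).isSelfAdjoint
  -- the degree is `m + 1`, so that the common factor of the variance below is invertible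
  refine nonneg_of_forall_nsmul_add_nonneg (z := Φ a - Φ a * Φ a) fun m => ?_
  set n := m + 1 with hn
  let q : ℕ → B := fun k => Φ (aeval a (bernsteinPolynomial ℝ n k))
  have hq : ∀ k, 0 ≤ q k := fun k =>
    Φ.map_nonneg (aeval_bernsteinPolynomial_nonneg h0 h1 n k)
  have hs0 : ∑ k ∈ Finset.range (n + 1), q k = 1 := by
    simp only [q]
    rw [← map_sum, ← map_sum, bernsteinPolynomial.sum, map_one, hΦ]
  have hs1 : ∑ k ∈ Finset.range (n + 1), k • q k = n • Φ a := by
    simp only [q, ← map_nsmul]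
    rw [← map_sum, ← map_sum, bernsteinPolynomial.sum_smul, map_nsmul, aeval_X]
  have hs2 : ∑ k ∈ Finset.range (n + 1), (k * k) • q k = (n * m) • Φ (a * a) + n • Φ a := by
    simp only [q, ← map_nsmul]
    rw [← map_sum, ← map_sum, bernsteinPolynomial_sum_sq_smul, map_add, map_nsmul, map_nsmul,
      map_pow, aeval_X, map_add, map_nsmul, map_nsmul, map_nsmul, sq, hn, Nat.add_sub_cancel]
  -- the variance of the distribution `q` about its mean `n • Φ a` is nonnegative
  have hvar : 0 ≤ ∑ k ∈ Finset.range (n + 1),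
      ((k : B) - n • Φ a) * q k * ((k : B) - n • Φ a) := by
    refine Finset.sum_nonneg fun k _ => ?_
    have hk : IsSelfAdjoint ((k : B) - n • Φ a) :=
      (IsSelfAdjoint.natCast k).sub (by rw [IsSelfAdjoint, star_nsmul, hsa.star_eq])
    exact hk.conjugate_nonneg (hq k)
  have hexp : ∑ k ∈ Finset.range (n + 1), ((k : B) - n • Φ a) * q k * ((k : B) - n • Φ a) =
      n • (m • (Φ (a * a) - Φ a * Φ a) + (Φ a - Φ a * Φ a)) := by
    have : ∀ k : ℕ, ((k : B) - n • Φ a) * q k * ((k : B) - n • Φ a) =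
        (k * k) • q k - (k • q k) * (n • Φ a) - (n • Φ a) * (k • q k)
          + (n • Φ a) * q k * (n • Φ a) := fun k => by
      simp only [nsmul_eq_mul, Nat.cast_mul]
      have hc : q k * (k : B) = k * q k := (Nat.cast_commute k _).symm
      simp only [sub_mul, mul_sub, mul_assoc, hc]
      abel
    simp only [this]
    rw [Finset.sum_add_distrib, Finset.sum_sub_distrib, Finset.sum_sub_distrib, hs2,
      ← Finset.sum_mul, ← Finset.mul_sum, hs1, ← Finset.sum_mul, ← Finset.mul_sum, hs0]
    simp only [mul_one, smul_add, smul_sub, smul_mul_smul_comm, smul_smul, hn]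
    rw [show (m + 1) * (m + 1) = (m + 1) * m + (m + 1) by ring]
    simp only [add_smul]
    abel
  rw [hexp, ← Nat.cast_smul_eq_nsmul ℝ] at hvar
  have h := smul_nonneg (by positivity : (0 : ℝ) ≤ (n : ℝ)⁻¹) hvar
  rwa [inv_smul_smul₀ (by positivity)] at h

/-- **Kadison's inequality**: a unital positive linear map between C*-algebras satisfies
`Φ a ^ 2 ≤ Φ (a ^ 2)` for self-adjoint `a`. -/
theorem PositiveLinearMap.map_mul_self_le_map_mul_self (Φ : A →ₚ[ℂ] B) (hΦ : Φ 1 = 1)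
    {a : A} (ha : IsSelfAdjoint a) : Φ a * Φ a ≤ Φ (a * a) := by
  -- an affine change of variable moves `a` between `0` and `1`
  set s : ℝ := ‖a‖ + 1 with hs
  have hs0 : 0 < s := by positivity
  set r : ℝ := (2 * s)⁻¹ with hr
  have hr0 : 0 < r := by positivity
  have h0 : 0 ≤ r • (s • (1 : A) + a) :=
    smul_nonneg hr0.le (ha.isStrictlyPositive_smul_one_add (lt_add_one _)).nonneg
  have h1 : r • (s • (1 : A) + a) ≤ 1 := by
    have h2 : 0 ≤ r • (s • (1 : A) + -a) := smul_nonneg hr0.le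
      (ha.neg.isStrictlyPositive_smul_one_add (by rw [norm_neg]; exact lt_add_one _)).nonneg
    have h3 : r • (s • (1 : A) + -a) = 1 - r • (s • (1 : A) + a) := by
      have h4 : (1 : A) = r • (s • (1 : A)) + r • (s • (1 : A)) := by
        rw [smul_smul, ← add_smul, show r * s + r * s = 1 by rw [hr]; field_simp; norm_num,
          one_smul]
      rw [smul_add, smul_add, smul_neg]
      nth_rw 2 [h4]
      abel
    rwa [h3, sub_nonneg] at h2
  have key := Φ.map_mul_self_le_map_mul_self_of_le_one hΦ h0 h1
  rw [← sub_nonneg] at key ⊢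
  have hexp : Φ (r • (s • (1 : A) + a) * r • (s • (1 : A) + a)) -
      Φ (r • (s • (1 : A) + a)) * Φ (r • (s • (1 : A) + a)) =
      (r * r) • (Φ (a * a) - Φ a * Φ a) := by
    simp only [PositiveLinearMap.map_smul_of_tower, add_mul, mul_add,
      map_add, smul_mul_assoc, mul_smul_comm, one_mul, mul_one, hΦ, smul_add, smul_sub]
    module
  rw [hexp] at key
  have h := smul_nonneg (by positivity : (0 : ℝ) ≤ (r * r)⁻¹) key
  rwa [inv_smul_smul₀ (by positivity)] at h

theorem PositiveLinearMap.isSelfAdjoint_map (Φ : A →ₚ[ℂ] B) {a : A} (ha : IsSelfAdjoint a) :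
    IsSelfAdjoint (Φ a) := by
  have h := (ha.isStrictlyPositive_smul_one_add (lt_add_one _)).nonneg
  have h1 := (Φ.map_nonneg h).isSelfAdjoint.sub
    (Φ.map_nonneg (smul_nonneg (by positivity : 0 ≤ ‖a‖ + 1) (zero_le_one (α := A)))).isSelfAdjoint
  rwa [← map_sub, add_sub_cancel_left] at h1

theorem PositiveLinearMap.map_star' (Φ : A →ₚ[ℂ] B) (a : A) : Φ (star a) = star (Φ a) := by
  have hr := (Φ.isSelfAdjoint_map (ℜ a).2).star_eq
  have hi := (Φ.isSelfAdjoint_map (ℑ a).2).star_eq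
  rw [← realPart_add_I_smul_imaginaryPart a]
  simp only [star_add, star_smul, map_add, map_smul, hr, hi, (ℜ a).2.star_eq, (ℑ a).2.star_eq]

/-- A linear map that squares self-adjoint elements preserves the Jordan product. -/
theorem LinearMap.map_jordan_of_map_mul_self {A B : Type*} [CStarAlgebra A] [CStarAlgebra B]
    (T : A →ₗ[ℂ] B) (hT : ∀ a, IsSelfAdjoint a → T (a * a) = T a * T a) (x y : A) :
    T (x * y + y * x) = T x * T y + T y * T x := by
  have hsa : ∀ a b : A, IsSelfAdjoint a → IsSelfAdjoint b →
      T (a * b) + T (b * a) = T a * T b + T b * T a := fun a b ha hb => by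
    have h := hT _ (ha.add hb)
    simp only [add_mul, mul_add, map_add, hT a ha, hT b hb] at h
    have h2 : ∀ p q r s u v : B, p + q + (r + s) = p + u + (v + s) → r + q = v + u := by
      intro p q r s u v h
      have : r + q = (p + q + (r + s)) - p - s := by abel
      rw [this, h]; abel
    exact h2 _ _ _ _ _ _ h
  have h1 := hsa _ _ (ℜ x).2 (ℜ y).2
  have h2 := hsa _ _ (ℜ x).2 (ℑ y).2
  have h3 := hsa _ _ (ℑ x).2 (ℜ y).2
  have h4 := hsa _ _ (ℑ x).2 (ℑ y).2
  rw [← realPart_add_I_smul_imaginaryPart x, ← realPart_add_I_smul_imaginaryPart y]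
  generalize (ℜ x : A) = a at *
  generalize (ℑ x : A) = b at *
  generalize (ℜ y : A) = c at *
  generalize (ℑ y : A) = d at *
  simp only [add_mul, mul_add, map_add, map_smul, smul_mul_assoc, mul_smul_comm, smul_add]
  calc _ = (T (a * c) + T (c * a)) + Complex.I • (T (a * d) + T (d * a))
      + Complex.I • (T (b * c) + T (c * b))
      + Complex.I • Complex.I • (T (b * d) + T (d * b)) := by simp only [smul_add]; abel
    _ = _ := by rw [h1, h2, h3, h4]; simp only [smul_add]; abel

/-- **Kadison's theorem**: a unital linear order isomorphism of C*-algebras is a Jordan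
*-isomorphism. -/
theorem exists_jordanStarIso_of_inverse_positiveLinearMaps (T : A →ₚ[ℂ] B) (S : B →ₚ[ℂ] A)
    (hT1 : T 1 = 1) (hST : ∀ a, S (T a) = a) (hTS : ∀ b, T (S b) = b) :
    ∃ J : JordanStarIso A B, ∀ a, J.toLinearEquiv a = T a := by
  have hS1 : S 1 = 1 := by rw [← hT1, hST]
  have hsq : ∀ a, IsSelfAdjoint a → T (a * a) = T a * T a := fun a ha => by
    refine le_antisymm ?_ (T.map_mul_self_le_map_mul_self hT1 ha)
    have h := S.map_mul_self_le_map_mul_self hS1 (T.isSelfAdjoint_map ha)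
    rw [hST] at h
    have := OrderHomClass.mono T h
    rwa [hTS] at this
  let e : A ≃ₗ[ℂ] B := { T.toLinearMap with invFun := S, left_inv := hST, right_inv := hTS }
  exact ⟨{ toLinearEquiv := e
           map_jordan := T.toLinearMap.map_jordan_of_map_mul_self hsq
           map_star := T.map_star' }, fun _ => rfl⟩

end Kadison

/-! ### Jordan *-isomorphisms and the functional calculus -/

section JordanStarIso

variable {A B : Type*} [CStarAlgebra A] [CStarAlgebra B]

namespace JordanStarIso

variable (J : JordanStarIso A B)

theorem map_mul_add_mul (x y : A) : J.toLinearEquiv (x * y + y * x) =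
    J.toLinearEquiv x * J.toLinearEquiv y + J.toLinearEquiv y * J.toLinearEquiv x :=
  J.map_jordan x y

theorem map_one : J.toLinearEquiv 1 = 1 := by
  -- apply the Jordan identity to the preimage `x` of `1`
  obtain ⟨x, hx⟩ := J.toLinearEquiv.surjective 1
  have h := J.map_mul_add_mul x 1
  rw [mul_one, one_mul, hx, mul_one, one_mul, map_add, hx, ← two_smul ℂ, ← two_smul ℂ] at h
  exact (smul_right_injective B (two_ne_zero' ℂ) h).symm

theorem map_pow (x : A) (n : ℕ) : J.toLinearEquiv (x ^ n) = J.toLinearEquiv x ^ n := by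
  induction n with
  | zero => simp [J.map_one]
  | succ n ih =>
    have h := J.map_mul_add_mul x (x ^ n)
    rw [ih, ← pow_succ, ← pow_succ', ← pow_succ, ← pow_succ', map_add, ← two_smul ℂ,
      ← two_smul ℂ] at h
    exact smul_right_injective B (two_ne_zero' ℂ) h

open Polynomial in
theorem map_aeval (q : ℝ[X]) (x : A) :
    J.toLinearEquiv (aeval x q) = aeval (J.toLinearEquiv x) q := by
  simp only [aeval_eq_sum_range, map_sum]
  refine Finset.sum_congr rfl fun i _ => ?_
  rw [← Complex.coe_smul, map_smul, J.map_pow, Complex.coe_smul]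

variable [PartialOrder A] [StarOrderedRing A] [PartialOrder B] [StarOrderedRing B]

theorem map_nonneg {x : A} (hx : 0 ≤ x) : 0 ≤ J.toLinearEquiv x := by
  have hs : IsSelfAdjoint (CFC.sqrt x) := (CFC.sqrt_nonneg x).isSelfAdjoint
  have hJ : IsSelfAdjoint (J.toLinearEquiv (CFC.sqrt x)) :=
    (J.map_star _).symm.trans (congrArg _ hs.star_eq)
  rw [← CFC.sqrt_mul_sqrt_self x hx, ← sq, J.map_pow]
  exact hJ.sq_nonneg

/-- A Jordan *-isomorphism, as a positive linear map. -/
noncomputable def toPositiveLinearMap : A →ₚ[ℂ] B :=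
  PositiveLinearMap.mk₀ J.toLinearEquiv.toLinearMap fun _ => J.map_nonneg

theorem continuous : Continuous J.toLinearEquiv :=
  map_continuous J.toPositiveLinearMap

/-- Invertibility survives because `x` dominates a positive scalar. -/
theorem map_isStrictlyPositive {x : A} (hx : IsStrictlyPositive x) :
    IsStrictlyPositive (J.toLinearEquiv x) := by
  cases subsingleton_or_nontrivial A
  · have := J.toLinearEquiv.symm.injective.subsingleton
    exact .of_subsingleton
  obtain ⟨r, hr, hrx⟩ := (CFC.exists_pos_algebraMap_le_iff hx.isSelfAdjoint).2
    fun _ h => hx.spectrum_pos h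
  have h := OrderHomClass.mono J.toPositiveLinearMap hrx
  rw [Algebra.algebraMap_eq_smul_one, PositiveLinearMap.map_smul_of_tower] at h
  exact (isStrictlyPositive_one.smul hr).of_le (by rw [← J.map_one]; exact h)

/-- Jordan *-isomorphisms commute with the continuous functional calculus, since they do so for
polynomials. -/
theorem map_cfc {f : ℝ → ℝ} {x : A} (hx : IsSelfAdjoint x)
    (hf : ContinuousOn f (spectrum ℝ x ∪ spectrum ℝ (J.toLinearEquiv x))) :
    J.toLinearEquiv (cfc f x) = cfc f (J.toLinearEquiv x) := by
  have hJx : IsSelfAdjoint (J.toLinearEquiv x) := (J.map_star x).symm.trans (congrArg _ hx.star_eq)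
  set K := spectrum ℝ x ∪ spectrum ℝ (J.toLinearEquiv x) with hK
  have hKc : IsCompact K :=
    (ContinuousFunctionalCalculus.isCompact_spectrum x).union
      (ContinuousFunctionalCalculus.isCompact_spectrum _)
  have : CompactSpace K := isCompact_iff_compactSpace.1 hKc
  let F : C(K, ℝ) := ⟨K.domRestrict f, continuousOn_iff_continuous_domRestrict.1 hf⟩
  have hF : F ∈ closure (polynomialFunctions K : Set C(K, ℝ)) := by
    rw [← Subalgebra.topologicalClosure_coe, polynomialFunctions.topologicalClosure]
    trivial
  obtain ⟨u, hu, hlim⟩ := mem_closure_iff_seq_limit.1 hF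
  simp only [polynomialFunctions_coe, Set.mem_range] at hu
  choose q hq using hu
  have hunif : TendstoUniformlyOn (fun n => (q n).eval) f atTop K := by
    rw [ContinuousMap.tendsto_iff_tendstoUniformly, Metric.tendstoUniformly_iff] at hlim
    refine Metric.tendstoUniformlyOn_iff.2 fun ε hε => (hlim ε hε).mono fun n hn t ht => ?_
    have := hn ⟨t, ht⟩
    rwa [← hq n] at this
  have hcont : ∀ (s : Set ℝ) n, ContinuousOn (q n).eval s := fun s n => (q n).continuous.continuousOn
  have h1 := tendsto_cfc_fun (hunif.mono Set.subset_union_left) (.of_forall (hcont _))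
  have h2 := tendsto_cfc_fun (hunif.mono Set.subset_union_right) (.of_forall (hcont _))
  refine tendsto_nhds_unique ((J.continuous.tendsto _).comp h1) (h2.congr fun n => ?_)
  rw [Function.comp_apply, cfc_polynomial _ _ hx, cfc_polynomial _ _ hJx, J.map_aeval]

theorem map_rpow {x : A} (hx : IsStrictlyPositive x) (p : ℝ) :
    J.toLinearEquiv (x ^ p) = J.toLinearEquiv x ^ p := by
  have hJx := J.map_isStrictlyPositive hx
  rw [CFC.rpow_eq_cfc_real hx.nonneg, CFC.rpow_eq_cfc_real hJx.nonneg,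
    J.map_cfc hx.isSelfAdjoint]
  -- both spectra avoid `0`, where a negative power would be discontinuous
  refine ContinuousOn.rpow_const continuousOn_id fun t ht => Or.inl (ne_of_gt ?_)
  exact ht.elim hx.spectrum_pos hJx.spectrum_pos

end JordanStarIso

end JordanStarIso

/-! ### Power means and the characterization -/

section PowerMean

variable {A B : Type*} [CStarAlgebra A] [PartialOrder A] [StarOrderedRing A]
  [CStarAlgebra B] [PartialOrder B] [StarOrderedRing B]

/-- `a ↦ a ^ p` as a bijection of the positive definite cone. -/
noncomputable def PosDefCone.rpowEquiv {p : ℝ} (hp : p ≠ 0) : PosDefCone A ≃ PosDefCone A where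
  toFun a := ⟨a.val ^ p, a.isStrictlyPositive.rpow a.val p⟩
  invFun a := ⟨a.val ^ (1 / p), a.isStrictlyPositive.rpow a.val (1 / p)⟩
  left_inv a := Subtype.ext <| by
    rw [one_div]; exact CFC.rpow_rpow_inv a.val p hp a.isStrictlyPositive
  right_inv a := Subtype.ext <| by
    rw [one_div]; exact CFC.rpow_inv_rpow a.val p hp a.isStrictlyPositive

theorem PosDefCone.val_rpowEquiv {p : ℝ} (hp : p ≠ 0) (a : PosDefCone A) :
    (PosDefCone.rpowEquiv hp a).val = a.val ^ p := rfl

/-- The midpoint of two elements of the positive definite cone. -/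
noncomputable def PosDefCone.midpoint (a b : PosDefCone A) : PosDefCone A :=
  ⟨(1 / 2 : ℝ) • (a.val + b.val),
    (a.isStrictlyPositive.add_nonneg b.isStrictlyPositive.nonneg).smul (by norm_num)⟩

/-- The power `a ↦ a ^ p` turns the power mean into the arithmetic mean. -/
theorem PosDefCone.rpowEquiv_powerMean {p : ℝ} (hp : p ≠ 0) (a b : PosDefCone A) :
    PosDefCone.rpowEquiv hp (powerMean p a b) =
      (PosDefCone.rpowEquiv hp a).midpoint (PosDefCone.rpowEquiv hp b) :=
  (PosDefCone.rpowEquiv hp).apply_symm_apply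
    ((PosDefCone.rpowEquiv hp a).midpoint (PosDefCone.rpowEquiv hp b))

/-- Conjugation `y ↦ x * y * x` by a self-adjoint element `x`, as a positive linear map. -/
noncomputable def IsSelfAdjoint.conjPositiveLinearMap {x : A} (hx : IsSelfAdjoint x) :
    A →ₚ[ℂ] A :=
  PositiveLinearMap.mk₀ ((LinearMap.mulRight ℂ x).comp (LinearMap.mulLeft ℂ x))
    fun _ hy => hx.conjugate_nonneg hy

/-- Midpoint-preserving bijections of positive definite cones are of the form `a ↦ D (J a) D`. -/
theorem exists_jordanStarIso_of_map_midpoint (ψ : PosDefCone A ≃ PosDefCone B)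
    (hψ : ∀ a b, ψ (a.midpoint b) = (ψ a).midpoint (ψ b)) :
    ∃ (J : JordanStarIso A B) (D : PosDefCone B), ∀ a,
      (ψ a).val = D.val * J.toLinearEquiv a.val * D.val := by
  classical
  -- the two cone maps, extended by junk values off the cones
  let f : A → B := fun a => if h : IsStrictlyPositive a then (ψ ⟨a, h⟩).val else 0
  let g : B → A := fun b => if h : IsStrictlyPositive b then (ψ.symm ⟨b, h⟩).val else 0
  have hf : ∀ a : PosDefCone A, f a.val = (ψ a).val := fun a => dif_pos a.isStrictlyPositive
  have hg : ∀ b : PosDefCone B, g b.val = (ψ.symm b).val := fun b => dif_pos b.isStrictlyPositive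
  have hψ' : ∀ a b, ψ.symm (a.midpoint b) = (ψ.symm a).midpoint (ψ.symm b) := fun a b => by
    rw [Equiv.symm_apply_eq, hψ, Equiv.apply_symm_apply, Equiv.apply_symm_apply]
  obtain ⟨T, S, hT, hST, hTS⟩ := exists_inverse_positiveLinearMaps f g
    (fun a b ha hb => by
      have := congrArg PosDefCone.val (hψ ⟨a, ha⟩ ⟨b, hb⟩)
      rw [← hf] at this
      exact this.trans (congrArg _ (congrArg₂ _ (hf ⟨a, ha⟩).symm (hf ⟨b, hb⟩).symm)))
    (fun a b ha hb => by
      have := congrArg PosDefCone.val (hψ' ⟨a, ha⟩ ⟨b, hb⟩)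
      rw [← hg] at this
      exact this.trans (congrArg _ (congrArg₂ _ (hg ⟨a, ha⟩).symm (hg ⟨b, hb⟩).symm)))
    (fun a ha => by
      have := hf ⟨a, ha⟩
      exact this ▸ (ψ ⟨a, ha⟩).isStrictlyPositive)
    (fun b hb => by
      have := hg ⟨b, hb⟩
      exact this ▸ (ψ.symm ⟨b, hb⟩).isStrictlyPositive)
    (fun a ha => (congrArg g (hf ⟨a, ha⟩)).trans
      ((hg _).trans (congrArg PosDefCone.val (ψ.symm_apply_apply ⟨a, ha⟩))))
    (fun b hb => (congrArg f (hg ⟨b, hb⟩)).trans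
      ((hf _).trans (congrArg PosDefCone.val (ψ.apply_symm_apply ⟨b, hb⟩))))
  have hψT : ∀ a : PosDefCone A, (ψ a).val = T a.val := fun a =>
    (hf a).symm.trans (hT _ a.isStrictlyPositive)
  have hT1 : IsStrictlyPositive (T 1) := by
    let one : PosDefCone A := ⟨1, isStrictlyPositive_one⟩
    have h := (ψ one).isStrictlyPositive
    rw [hψT] at h
    exact h
  -- normalize `T` to a unital map by conjugating with the inverse square root of `T 1`
  set D : B := CFC.sqrt (T 1) with hD
  have hDpos : IsStrictlyPositive D := hT1.sqrt _
  obtain ⟨u, hu⟩ := hDpos.isUnit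
  have hDD : D * D = T 1 := CFC.sqrt_mul_sqrt_self _ hT1.nonneg
  set E : B := (↑u⁻¹ : B) with hE
  have hDE : D * E = 1 := by rw [← hu, hE, Units.mul_inv]
  have hED : E * D = 1 := by rw [← hu, hE, Units.inv_mul]
  have hDsa : IsSelfAdjoint D := hDpos.isSelfAdjoint
  have hEsa : IsSelfAdjoint E := by
    have h1 : star E * D = 1 := by rw [← hDsa.star_eq, ← star_mul, hDE, star_one]
    calc star E = star E * (D * E) := by rw [hDE, mul_one]
      _ = E := by rw [← mul_assoc, h1, one_mul]
  obtain ⟨J, hJ⟩ := exists_jordanStarIso_of_inverse_positiveLinearMaps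
    (hEsa.conjPositiveLinearMap.comp T) (S.comp hDsa.conjPositiveLinearMap)
    (by
      change E * T 1 * E = 1
      rw [← hDD, ← mul_assoc, hED, one_mul, hDE])
    (fun a => by
      change S (D * (E * T a * E) * D) = a
      rw [show D * (E * T a * E) * D = (D * E) * T a * (E * D) by simp only [mul_assoc],
        hDE, hED, one_mul, mul_one, hST])
    (fun b => by
      change E * T (S (D * b * D)) * E = b
      rw [hTS, show E * (D * b * D) * E = (E * D) * b * (D * E) by simp only [mul_assoc],
        hDE, hED, one_mul, mul_one])
  refine ⟨J, ⟨D, hDpos⟩, fun a => ?_⟩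
  rw [hJ, hψT]
  change _ = D * (E * T a.val * E) * D
  rw [show D * (E * T a.val * E) * D = (D * E) * T a.val * (E * D) by simp only [mul_assoc],
    hDE, hED, one_mul, mul_one]

end PowerMean

theorem theorem1 {A B : Type*} [CStarAlgebra A] [PartialOrder A] [StarOrderedRing A]
    [CStarAlgebra B] [PartialOrder B] [StarOrderedRing B]
    (p : ℝ) (hp : p ≠ 0) (φ : PosDefCone A → PosDefCone B) (hφ : Function.Bijective φ) :
    (∀ a b : PosDefCone A, φ (powerMean p a b) = powerMean p (φ a) (φ b)) ↔
      ∃ (J : JordanStarIso A B) (D : PosDefCone B), ∀ a : PosDefCone A,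
        (φ a).val = (D.val * (J.toLinearEquiv a.val) ^ p * D.val) ^ (1 / p) := by
  -- `PB ∘ φ ∘ PA⁻¹` preserves midpoints exactly if `φ` preserves power means
  let PA := PosDefCone.rpowEquiv (A := A) hp
  let PB := PosDefCone.rpowEquiv (A := B) hp
  have hsymm : ∀ a, (PB.symm a).val = a.val ^ (1 / p) := fun a => rfl
  constructor
  · intro h
    let ψ : PosDefCone A ≃ PosDefCone B := (PA.symm.trans (Equiv.ofBijective φ hφ)).trans PB
    have hψ : ∀ a, ψ (PA a) = PB (φ a) := fun a => by simp [ψ]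
    have hmid : ∀ a b, ψ (a.midpoint b) = (ψ a).midpoint (ψ b) := fun a b => by
      obtain ⟨a, rfl⟩ := PA.surjective a
      obtain ⟨b, rfl⟩ := PA.surjective b
      rw [← PosDefCone.rpowEquiv_powerMean, hψ, hψ, hψ, h, PosDefCone.rpowEquiv_powerMean]
    obtain ⟨J, D, hJ⟩ := exists_jordanStarIso_of_map_midpoint ψ hmid
    refine ⟨J, D, fun a => ?_⟩
    rw [← J.map_rpow a.isStrictlyPositive, ← PosDefCone.val_rpowEquiv hp a, ← hJ, hψ, ← hsymm,
      Equiv.symm_apply_apply]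
  · rintro ⟨J, D, h⟩ a b
    have hval : ∀ c, (PB (φ c)).val = D.val * J.toLinearEquiv (PA c).val * D.val := fun c => by
      have hpos : IsStrictlyPositive (D.val * (J.toLinearEquiv c.val) ^ p * D.val) :=
        IsStrictlyPositive.conjugate_of_isUnit_of_isSelfAdjoint _ _ D.isStrictlyPositive.isUnit
          D.isStrictlyPositive.isSelfAdjoint
          ((J.map_isStrictlyPositive c.isStrictlyPositive).rpow _ p)
      rw [PosDefCone.val_rpowEquiv, PosDefCone.val_rpowEquiv, h, one_div,
        CFC.rpow_inv_rpow _ p hp hpos, J.map_rpow c.isStrictlyPositive]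
    refine PB.injective (Subtype.ext ?_)
    change (PB _).val = (PB _).val
    rw [hval, PosDefCone.rpowEquiv_powerMean, PosDefCone.rpowEquiv_powerMean]
    change D.val * J.toLinearEquiv ((1 / 2 : ℝ) • ((PA a).val + (PA b).val)) * D.val =
      (1 / 2 : ℝ) • ((PB (φ a)).val + (PB (φ b)).val)
    rw [hval, hval, ← Complex.coe_smul, map_smul, Complex.coe_smul, map_add]
    simp only [mul_add, add_mul, mul_smul_comm, smul_mul_assoc]
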